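/- Let $F_A$ be the free group on a set $A$, let $k\ge 1$, and let $\mathbf S_k$ be the class of all finite groups $Q$ whose $k$-th derived subgroup $Q^{(k)}$ is trivial. The pro-$\mathbf S_k$ topology on $F_A$ is the coarsest topology making every homomorphism from $F_A$ to a discrete group in $\mathbf S_k$ continuous; write $\mathrm{Cl}_{\mathbf S_k}(H)$ for the closure of a subgroup $H$ in this topology (it is again a subgroup). Let $H\le F_A$ be a finitely generated subgroup. Then: (i) $H F_A^{(k)}\subseteq \mathrm{Cl}_{\mathbf S_k}(H)$, where $F_A^{(k)}$ is the $k$-th derived subgroup of $F_A$. (ii) If $A$ is infinite, then $\mathrm{Cl}_{\mathbf S_k}(H)$ is not finitely generated. (iii) If $A$ is finite, and it is not the case that both $|A|=1$ and $H=\{1\}$, then $\mathrm{Cl}_{\mathbf S_k}(H)$ is finitely generated if and only if it has finite index in $F_A$. (iv) It is decidable whether $H$ is closed in the pro-$\mathbf S_k$ topology. Precisely, let the basis $A$ be fixed and let letters of $A$ be named injectively by the elements of an effectively coded set $B$, via an injection $B\hookrightarrow A$ (for countable, effectively coded $A$ one may take $B=A$). Then there is an algorithm which, given $k\ge 1$ and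 a finite list of words over $B\cup B^{-1}$, decides whether the subgroup of $F_A$ generated by the elements these words represent is closed in the pro-$\mathbf S_k$ topology. -/

import Mathlib

open scoped Topology Pointwise

/-- Membership of a group in the pseudovariety `S_k` of all finite `k`-solvable groups, that is,
finite groups whose `k`-th derived subgroup is trivial. -/
def FiniteKSolvable (k : ℕ) (Q : Type) [Group Q] : Prop :=
  Finite Q ∧ derivedSeries Q k = ⊥

/-- The pro-`V` topology on a group `G`, for a class `V` of finite groups: the coarsest topology
that makes every homomorphism from `G` into a member of `V` (with the discrete topology `⊥`)
continuous. Every finite group has an isomorphic copy in `Type`, so for an isomorphism-invariant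
class it suffices to let `Q` range over `Type`. -/
def proTopology (V : ∀ (Q : Type) [Group Q], Prop) (G : Type*) [Group G] : TopologicalSpace G :=
  ⨅ (Q : Type) (_ : Group Q) (_ : V Q) (f : G →* Q), TopologicalSpace.induced f ⊥

theorem isTopologicalGroup_proTopology (V : ∀ (Q : Type) [Group Q], Prop)
    (G : Type*) [Group G] : @IsTopologicalGroup G (proTopology V G) _ := by
  unfold proTopology
  refine topologicalGroup_iInf fun Q => topologicalGroup_iInf fun _ =>
    topologicalGroup_iInf fun _ => topologicalGroup_iInf fun f => ?_
  let _ : TopologicalSpace Q := ⊥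
  have : DiscreteTopology Q := ⟨rfl⟩
  exact topologicalGroup_induced f

/-- The closure of a subgroup `H` of `G` in the pro-`V` topology, as a subgroup of `G`. Its
underlying set is the topological closure of `H`. -/
def proClosure (V : ∀ (Q : Type) [Group Q], Prop) {G : Type*} [Group G] (H : Subgroup G) :
    Subgroup G :=
  @Subgroup.topologicalClosure G (proTopology V G) _ (isTopologicalGroup_proTopology V G) H

theorem coe_proClosure (V : ∀ (Q : Type) [Group Q], Prop) {G : Type*} [Group G]
    (H : Subgroup G) :
    (proClosure V H : Set G) = @closure G (proTopology V G) (H : Set G) := rfl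

/-- A finite list of words over the letters `b` and their inverses, where `(b, true)` stands for
`b` and `(b, false)` for `b⁻¹`, generates this subgroup of the free group on `A` when the letter
`b` is the name of the element `ν b` of `A`. -/
def subgroupOfWords {A B : Type*} (ν : B → A) (L : List (List (B × Bool))) :
    Subgroup (FreeGroup A) :=
  Subgroup.closure {g | ∃ w ∈ L, g = FreeGroup.mk (w.map fun x => (ν x.1, x.2))}

/-! ### The pro-`S_k` topology and the derived subgroup. -/

section ProTopology

variable {G : Type*} [Group G]

/-! Write `F` for the free group and `D` for its `k`-th derived subgroup. Homomorphisms to groups in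
`S_k` kill `D`, so open sets are unions of cosets of `D`, and every closure `K` contains `D`. This
gives (i) and reduces the rest to subgroups above `D`.

In rank at least two `D` is nontrivial, since `F` maps onto the nonsolvable group `S_5`. A finitely
generated `K` containing a nontrivial normal subgroup has finite index (`suffixCosets_eq_univ`):
reduced words of elements of `K` trace loops in the finite part of the coset graph spanned by the
generating words, and conjugates of one nontrivial element have reduced words with arbitrary reduced
endings, so this part is the whole graph. If the basis is infinite, a map onto `S_5` that kills the
finitely many letters of the generators shows that `K` cannot contain `D`.

Hence a finitely generated `H` is closed exactly when `D ≤ H`: either `H` has finite index and the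
coset action lies in `S_k`, or the rank is at most one, `D` is trivial and M. Hall's theorem
applies. For a finite basis with at least two letters, `derivedSeries_le_wordSubgroup_iff` turns `D
≤ H` into a check over permutation representations of one computable degree; otherwise the answer is
constant for `k ≥ 1`. -/

theorem isClosed_proTopology_preimage {V : ∀ (Q : Type) [Group Q], Prop} {Q : Type} [hQ : Group Q]
    (hV : V Q) (f : G →* Q) (s : Set Q) : IsClosed[proTopology V G] (f ⁻¹' s) := by
  have hle : proTopology V G ≤ TopologicalSpace.induced f ⊥ :=
    iInf_le_of_le Q <| iInf_le_of_le hQ <| iInf_le_of_le hV <| iInf_le _ f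
  refine IsClosed.mono ?_ hle
  let _ : TopologicalSpace Q := ⊥
  have : DiscreteTopology Q := ⟨rfl⟩
  exact isClosed_induced_iff.2 ⟨s, isClosed_discrete s, rfl⟩

/-- A homomorphism to a group in `S_k` factors through the quotient by the derived subgroup. As `≤`
means finer, every open set is then a union of cosets of that subgroup. -/
theorem induced_mk_derivedSeries_le_proTopology (k : ℕ) :
    TopologicalSpace.induced (QuotientGroup.mk' (derivedSeries G k)) ⊥ ≤
      proTopology (FiniteKSolvable k) G := by
  refine le_iInf fun Q => le_iInf fun _ => le_iInf fun hQ => le_iInf fun f => ?_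
  have hf : derivedSeries G k ≤ f.ker := by
    rw [← MonoidHom.comap_bot, ← Subgroup.map_le_iff_le_comap, ← hQ.2]
    exact map_derivedSeries_le_derivedSeries f k
  have h : (f : G → Q) =
      QuotientGroup.lift _ f hf ∘ QuotientGroup.mk' (derivedSeries G k) := rfl
  rw [h, ← induced_compose]
  exact induced_mono bot_le

theorem mem_of_isOpen_proTopology {k : ℕ} {U : Set G}
    (hU : IsOpen[proTopology (FiniteKSolvable k) G] U) {g d : G} (hd : d ∈ derivedSeries G k)
    (hg : g * d ∈ U) : g ∈ U := by
  obtain ⟨t, -, rfl⟩ := induced_mk_derivedSeries_le_proTopology k U hU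
  have : QuotientGroup.mk' (derivedSeries G k) (g * d) = QuotientGroup.mk' (derivedSeries G k) g :=
    (QuotientGroup.eq.2 (by simpa using hd)).symm
  simpa only [Set.mem_preimage, this] using hg

theorem mul_derivedSeries_subset_proClosure (k : ℕ) (H : Subgroup G) :
    (H : Set G) * (derivedSeries G k : Set G) ⊆ (proClosure (FiniteKSolvable k) H : Set G) := by
  rintro _ ⟨h, hh, d, hd, rfl⟩
  rw [coe_proClosure, @mem_closure_iff]
  exact fun U hU hg => ⟨h, mem_of_isOpen_proTopology hU hd hg, hh⟩

theorem derivedSeries_le_proClosure (k : ℕ) (H : Subgroup G) :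
    derivedSeries G k ≤ proClosure (FiniteKSolvable k) H :=
  fun d hd => mul_derivedSeries_subset_proClosure k H ⟨1, H.one_mem, d, hd, one_mul d⟩

theorem le_proClosure (k : ℕ) (H : Subgroup G) : H ≤ proClosure (FiniteKSolvable k) H :=
  fun h hh => mul_derivedSeries_subset_proClosure k H
    ⟨h, hh, 1, (derivedSeries G k).one_mem, mul_one h⟩

theorem derivedSeries_le_of_isClosed {k : ℕ} {H : Subgroup G}
    (hH : IsClosed[proTopology (FiniteKSolvable k) G] (H : Set G)) : derivedSeries G k ≤ H := by
  have h : (proClosure (FiniteKSolvable k) H : Set G) = H :=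
    @IsClosed.closure_eq G (proTopology (FiniteKSolvable k) G) _ hH
  exact (derivedSeries_le_proClosure k H).trans (SetLike.coe_injective h).le

theorem isClosed_of_forall_exists_hom {k : ℕ} {H : Subgroup G}
    (h : ∀ g ∉ H, ∃ (Q : Type) (_ : Group Q) (f : G →* Q),
      FiniteKSolvable k Q ∧ f g ∉ f '' (H : Set G)) :
    IsClosed[proTopology (FiniteKSolvable k) G] (H : Set G) := by
  rw [← @isOpen_compl_iff, @isOpen_iff_forall_mem_open]
  intro g hg
  obtain ⟨Q, _, f, hQ, hf⟩ := h g hg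
  refine ⟨(f ⁻¹' (f '' H))ᶜ, Set.compl_subset_compl.2 (Set.subset_preimage_image f H), ?_, hf⟩
  rw [@isOpen_compl_iff]
  exact isClosed_proTopology_preimage hQ f _

/-- A homomorphism to a finite symmetric group that kills the `k`-th derived subgroup separates
from `H` every element that moves a point fixed by `H`. -/
theorem exists_hom_of_perm {k : ℕ} {H : Subgroup G} {N : ℕ} (f : G →* Equiv.Perm (Fin N))
    (hf : derivedSeries G k ≤ f.ker) {x : Fin N} (hH : ∀ h ∈ H, f h x = x) {g : G}
    (hg : f g x ≠ x) : ∃ (Q : Type) (_ : Group Q) (f : G →* Q),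
      FiniteKSolvable k Q ∧ f g ∉ f '' (H : Set G) := by
  refine ⟨f.range, inferInstance, f.rangeRestrict, ⟨inferInstance, ?_⟩, ?_⟩
  · rw [← map_derivedSeries_eq f.rangeRestrict_surjective, Subgroup.map_eq_bot_iff,
      MonoidHom.ker_rangeRestrict]
    exact hf
  · rintro ⟨h, hh, hgh⟩
    have : f h = f g := congrArg Subtype.val hgh
    exact hg (this ▸ hH h hh)

/-- The permutation action on cosets of `H` does the separation: the derived subgroup is normal and
inside `H`, so it acts trivially, while the stabilizer of the base coset is `H`. -/
theorem isClosed_of_derivedSeries_le {k : ℕ} {H : Subgroup G} [Finite (G ⧸ H)]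
    (hH : derivedSeries G k ≤ H) : IsClosed[proTopology (FiniteKSolvable k) G] (H : Set G) := by
  obtain ⟨N, ⟨e⟩⟩ := Finite.exists_equiv_fin (G ⧸ H)
  let f : G →* Equiv.Perm (Fin N) := e.permCongrHom.toMonoidHom.comp (MulAction.toPermHom G (G ⧸ H))
  have hf (g : G) (i : Fin N) : f g i = e (g • e.symm i) := rfl
  refine isClosed_of_forall_exists_hom fun g hg => exists_hom_of_perm f ?_
    (x := e ((1 : G) : G ⧸ H)) ?_ ?_
  · intro d hd
    ext i
    rw [hf]
    obtain ⟨y, hy⟩ := QuotientGroup.mk_surjective (e.symm i)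
    have : d • e.symm i = e.symm i := by
      rw [← hy, MulAction.Quotient.smul_coe, eq_comm, QuotientGroup.eq, smul_eq_mul, ← mul_assoc]
      have := (derivedSeries_normal G k).conj_mem d hd y⁻¹
      rw [inv_inv] at this
      exact hH this
    simp [this]
  · intro h hh
    rw [hf, e.symm_apply_apply, MulAction.Quotient.smul_coe, smul_eq_mul, mul_one]
    congr 1
    rw [eq_comm, QuotientGroup.eq]
    simpa using hh
  · rw [hf, e.symm_apply_apply, MulAction.Quotient.smul_coe, smul_eq_mul, mul_one]
    intro h
    rw [e.apply_eq_iff_eq, eq_comm, QuotientGroup.eq] at h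
    exact hg (by simpa using h)

end ProTopology

/-! ### Suffix cosets: the finite part of the coset graph spanned by generating words. -/

namespace FreeGroup

section WordSubgroup

variable {α : Type*}

/-- The subgroup of a free group generated by the elements that the words of a list represent. -/
def wordSubgroup (L : List (List (α × Bool))) : Subgroup (FreeGroup α) :=
  Subgroup.closure {g | ∃ w ∈ L, g = mk w}

theorem mk_mem_wordSubgroup {L : List (List (α × Bool))} {w : List (α × Bool)} (hw : w ∈ L) :
    mk w ∈ wordSubgroup L :=
  Subgroup.subset_closure ⟨w, hw, rfl⟩

theorem exists_wordSubgroup_eq {H : Subgroup (FreeGroup α)} (hH : H.FG) :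
    ∃ L : List (List (α × Bool)), wordSubgroup L = H := by
  classical
  obtain ⟨S, rfl⟩ := hH
  have hS : {g | ∃ w ∈ S.toList.map toWord, g = mk w} = (S : Set (FreeGroup α)) := by
    ext g
    simp [mk_toWord]
  exact ⟨S.toList.map toWord, by rw [wordSubgroup, hS]⟩

/-- The suffixes of the words in a list, together with the empty word. -/
def suffixes {β : Type*} (L : List (List β)) : List (List β) :=
  [] :: L.flatMap List.tails

theorem mem_suffixes {β : Type*} {L : List (List β)} {u : List β} :
    u ∈ suffixes L ↔ u = [] ∨ ∃ w ∈ L, u <:+ w := by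
  simp [suffixes]

theorem suffix_append_iff {β : Type*} {u v w : List β} :
    u <:+ v ++ w ↔ u <:+ w ∨ ∃ t, u = t ++ w ∧ t <:+ v := by
  constructor
  · rintro ⟨t, ht⟩
    rcases List.append_eq_append_iff.1 ht with ⟨a, rfl, rfl⟩ | ⟨a, rfl, rfl⟩
    · exact .inr ⟨a, rfl, t, rfl⟩
    · exact .inl ⟨a, rfl⟩
  · rintro (h | ⟨t, rfl, t', rfl⟩)
    · exact h.trans (List.suffix_append v w)
    · exact ⟨t', by simp⟩

theorem mem_suffixes_of_isSuffix {β : Type*} {L : List (List β)} {u v : List β}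
    (hv : v ∈ suffixes L) (h : u <:+ v) : u ∈ suffixes L := by
  rw [mem_suffixes] at *
  rcases hv with rfl | ⟨w, hw, hvw⟩
  · exact .inl (List.suffix_nil.1 h)
  · exact .inr ⟨w, hw, h.trans hvw⟩

/-- The cosets of the subgroup generated by a list of words that are represented by suffixes of
these words. -/
def suffixCosets (L : List (List (α × Bool))) : Set (FreeGroup α ⧸ wordSubgroup L) :=
  {x | ∃ s ∈ suffixes L, (mk s : FreeGroup α ⧸ wordSubgroup L) = x}

theorem suffixCosets_eq_image (L : List (List (α × Bool))) :
    suffixCosets L = (fun s => (mk s : FreeGroup α ⧸ wordSubgroup L)) '' {s | s ∈ suffixes L} := rfl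

theorem finite_suffixCosets (L : List (List (α × Bool))) : (suffixCosets L).Finite :=
  (List.finite_toSet (suffixes L)).image _

theorem ncard_suffixCosets_le (L : List (List (α × Bool))) :
    (suffixCosets L).ncard ≤ (suffixes L).length := by
  classical
  rw [suffixCosets_eq_image, ← List.coe_toFinset, ← Finset.coe_image, Set.ncard_coe_finset]
  exact Finset.card_image_le.trans (List.toFinset_card_le _)

theorem one_mem_suffixCosets (L : List (List (α × Bool))) :
    ((1 : FreeGroup α) : FreeGroup α ⧸ wordSubgroup L) ∈ suffixCosets L :=
  ⟨[], by simp [suffixes], rfl⟩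

theorem suffix_mem_suffixCosets {L : List (List (α × Bool))} {w u : List (α × Bool)} (hw : w ∈ L)
    (hu : u <:+ w) : (mk u : FreeGroup α ⧸ wordSubgroup L) ∈ suffixCosets L :=
  ⟨u, mem_suffixes.2 (.inr ⟨w, hw, hu⟩), rfl⟩

/-- Words act on left cosets from their right end, so suffixes give the vertices visited from the
base coset. As `w` is a loop there, reading `v` after `w` retraces the path of `v`. -/
theorem suffix_append_mem_suffixCosets {L : List (List (α × Bool))} {v w : List (α × Bool)}
    (hv : ∀ u, u <:+ v → (mk u : FreeGroup α ⧸ wordSubgroup L) ∈ suffixCosets L)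
    (hw : ∀ u, u <:+ w → (mk u : FreeGroup α ⧸ wordSubgroup L) ∈ suffixCosets L)
    (hwL : mk w ∈ wordSubgroup L) {u : List (α × Bool)} (hu : u <:+ v ++ w) :
    (mk u : FreeGroup α ⧸ wordSubgroup L) ∈ suffixCosets L := by
  rcases suffix_append_iff.1 hu with h | ⟨t, rfl, ht⟩
  · exact hw u h
  · have : (mk t : FreeGroup α ⧸ wordSubgroup L) = mk (t ++ w) := by
      rw [QuotientGroup.eq, ← mul_mk, inv_mul_cancel_left]
      exact hwL
    exact this ▸ hv t ht

/-- The inverse of a loop visits the same vertices backwards. -/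
theorem suffix_invRev_mem_suffixCosets {L : List (List (α × Bool))} {w : List (α × Bool)}
    (hw : ∀ u, u <:+ w → (mk u : FreeGroup α ⧸ wordSubgroup L) ∈ suffixCosets L)
    (hwL : mk w ∈ wordSubgroup L) {u : List (α × Bool)} (hu : u <:+ invRev w) :
    (mk u : FreeGroup α ⧸ wordSubgroup L) ∈ suffixCosets L := by
  obtain ⟨t, ht⟩ := hu
  have hw' : w = invRev u ++ invRev t := by rw [← invRev_append, ht, invRev_invRev]
  have : (mk (invRev t) : FreeGroup α ⧸ wordSubgroup L) = mk u := by
    rw [eq_comm, QuotientGroup.eq, inv_mk, mul_mk, ← hw']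
    exact hwL
  exact this ▸ hw _ ⟨invRev u, hw'.symm⟩

/-- Cancelling a pair only removes a backtrack: each suffix left represents the same element as some
suffix before. -/
theorem Red.suffix_mem_suffixCosets {L : List (List (α × Bool))} {v w : List (α × Bool)}
    (h : Red v w) (hv : ∀ u, u <:+ v → (mk u : FreeGroup α ⧸ wordSubgroup L) ∈ suffixCosets L) :
    ∀ u, u <:+ w → (mk u : FreeGroup α ⧸ wordSubgroup L) ∈ suffixCosets L := by
  induction h with
  | refl => exact hv
  | tail _ hstep ih =>
    obtain @⟨v₁, v₂, x, b⟩ := hstep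
    intro u hu
    rcases suffix_append_iff.1 hu with h | ⟨t, rfl, t', rfl⟩
    · exact ih u (h.trans ⟨v₁ ++ [(x, b), (x, !b)], by simp⟩)
    · have : mk (t ++ v₂) = mk (t ++ (x, b) :: (x, !b) :: v₂) := (Quot.sound Red.Step.not).symm
      rw [this]
      exact ih _ ⟨t', by simp⟩

theorem suffix_toWord_mem_suffixCosets [DecidableEq α] {L : List (List (α × Bool))}
    {h : FreeGroup α} (hh : h ∈ wordSubgroup L) {u : List (α × Bool)} (hu : u <:+ h.toWord) :
    (mk u : FreeGroup α ⧸ wordSubgroup L) ∈ suffixCosets L := by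
  obtain ⟨w, rfl, hw⟩ : ∃ w : List (α × Bool), mk w = h ∧
      ∀ u, u <:+ w → (mk u : FreeGroup α ⧸ wordSubgroup L) ∈ suffixCosets L := by
    refine Subgroup.closure_induction (p := fun h _ => ∃ w : List (α × Bool), mk w = h ∧
      ∀ u, u <:+ w → (mk u : FreeGroup α ⧸ wordSubgroup L) ∈ suffixCosets L) ?_ ?_ ?_ ?_ hh
    · rintro _ ⟨w, hw, rfl⟩
      exact ⟨w, rfl, fun u => FreeGroup.suffix_mem_suffixCosets hw⟩
    · refine ⟨[], rfl, fun u hu => ?_⟩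
      rw [List.suffix_nil.1 hu]
      exact one_mem_suffixCosets L
    · rintro _ _ _ hy ⟨v, rfl, hv⟩ ⟨w, rfl, hw⟩
      exact ⟨v ++ w, mul_mk.symm, fun u => suffix_append_mem_suffixCosets hv hw hy⟩
    · rintro _ hx ⟨w, rfl, hw⟩
      exact ⟨invRev w, inv_mk.symm, fun u => suffix_invRev_mem_suffixCosets hw hx⟩
  rw [toWord_mk] at hu
  exact reduce.red.suffix_mem_suffixCosets hw u hu

theorem exists_letter_ne [Nontrivial α] (x y z : α × Bool) :
    ∃ c : α × Bool, c ≠ x ∧ c ≠ y ∧ c ≠ z := by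
  classical
  obtain ⟨a, b, hab⟩ := exists_pair_ne α
  by_contra! h
  have hsub : ({(a, true), (a, false), (b, true), (b, false)} : Finset (α × Bool)) ⊆
      {x, y, z} := by
    intro c _
    have := h c
    simp only [Finset.mem_insert, Finset.mem_singleton]
    tauto
  have h1 := Finset.card_le_card hsub
  have h2 : ({(a, true), (a, false), (b, true), (b, false)} : Finset (α × Bool)).card = 4 := by
    simp [Finset.card_insert_of_notMem, hab]
  exact absurd (h1.trans Finset.card_le_three) (by omega)

theorem isReduced_invRev {w : List (α × Bool)} (hw : IsReduced w) : IsReduced (invRev w) := by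
  classical
  exact .of_reduce_eq (by rw [reduce_invRev, hw.reduce_eq])

/-- A nontrivial element can be conjugated so that the reduced form of the result ends in a given
reduced word. -/
theorem exists_conj_suffix [DecidableEq α] [Nontrivial α] {n : FreeGroup α} (hn : n ≠ 1)
    (g : FreeGroup α) : ∃ c : FreeGroup α, g.toWord <:+ (c⁻¹ * n * c).toWord := by
  obtain ⟨x, v, hx⟩ := List.exists_cons_of_ne_nil (mt toWord_eq_nil_iff.1 hn)
  obtain ⟨v', y, hy⟩ := List.eq_nil_or_concat n.toWord |>.resolve_left (mt toWord_eq_nil_iff.1 hn)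
  have flip (p q : α × Bool) (h : q ≠ (p.1, !p.2)) : p.1 = q.1 → p.2 = q.2 := by
    rintro h1
    by_contra h2
    exact h (Prod.ext h1.symm (by rcases p with ⟨_, _ | _⟩ <;> rcases q with ⟨_, _ | _⟩ <;> simp_all))
  -- With `c = z * g`, the three conditions on `z` exclude cancellation at the three junctions of
  -- `g⁻¹ z⁻¹ · n · z · g`. Each forbids at most one letter, and at least four are available.
  obtain ⟨z, hzx, hzy, hzg⟩ : ∃ z : α × Bool, z ≠ x ∧ z ≠ (y.1, !y.2) ∧
      ∀ p ∈ g.toWord.head?, z.1 = p.1 → z.2 = p.2 := by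
    rcases hg : g.toWord with _ | ⟨p, u⟩
    · obtain ⟨z, h⟩ := exists_letter_ne x (y.1, !y.2) x
      exact ⟨z, h.1, h.2.1, by simp⟩
    · obtain ⟨z, h⟩ := exists_letter_ne x (y.1, !y.2) (p.1, !p.2)
      refine ⟨z, h.1, h.2.1, fun q hq h1 => ?_⟩
      obtain rfl : p = q := by simpa using hq
      exact (flip p z h.2.2 h1.symm).symm
  refine ⟨mk (z :: g.toWord), ?_⟩
  have hc : IsReduced (z :: g.toWord) := List.isChain_cons.2 ⟨hzg, isReduced_toWord⟩
  have hright : IsReduced (n.toWord ++ z :: g.toWord) := by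
    refine List.isChain_append.2 ⟨isReduced_toWord, hc, fun p hp q hq => ?_⟩
    rw [hy] at hp
    obtain rfl : y = p := by simpa using hp
    obtain rfl : z = q := by simpa using hq
    exact flip _ _ hzy
  have hall : IsReduced (invRev (z :: g.toWord) ++ (n.toWord ++ z :: g.toWord)) := by
    refine List.isChain_append.2 ⟨isReduced_invRev hc, hright, fun p hp q hq => ?_⟩
    rw [hx] at hq
    obtain rfl : x = q := by simpa using hq
    obtain rfl : (z.1, !z.2) = p := by simpa [invRev] using hp
    exact flip _ _ (by simpa using hzx.symm)
  have : (mk (z :: g.toWord))⁻¹ * n * mk (z :: g.toWord) =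
      mk (invRev (z :: g.toWord) ++ (n.toWord ++ z :: g.toWord)) := by
    rw [← mul_mk, ← mul_mk, ← inv_mk, mk_toWord, mul_assoc]
  rw [this, toWord_mk, hall.reduce_eq]
  exact ⟨invRev (z :: g.toWord) ++ n.toWord ++ [z], by simp⟩

/-- If a finitely generated subgroup contains a nontrivial normal subgroup, then each of its cosets
is represented by a suffix of a generating word. -/
theorem suffixCosets_eq_univ [Nontrivial α] {L : List (List (α × Bool))}
    {N : Subgroup (FreeGroup α)} [hN : N.Normal] (hN1 : N ≠ ⊥) (hNL : N ≤ wordSubgroup L) :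
    suffixCosets L = Set.univ := by
  classical
  refine Set.eq_univ_of_forall fun x => ?_
  obtain ⟨g, rfl⟩ := QuotientGroup.mk_surjective x
  obtain ⟨n, hn, hn1⟩ := N.bot_or_exists_ne_one.resolve_left hN1
  obtain ⟨c, hc⟩ := exists_conj_suffix hn1 g
  have hmem : c⁻¹ * n * c ∈ N := by simpa using hN.conj_mem n hn c⁻¹
  simpa [mk_toWord] using suffix_toWord_mem_suffixCosets (hNL hmem) hc

theorem finite_quotient_of_normal_le [Nontrivial α] {K N : Subgroup (FreeGroup α)} (hK : K.FG)
    [N.Normal] (hN1 : N ≠ ⊥) (hNK : N ≤ K) : Finite (FreeGroup α ⧸ K) := by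
  obtain ⟨L, rfl⟩ := exists_wordSubgroup_eq hK
  exact Set.finite_univ_iff.1 (suffixCosets_eq_univ hN1 hNK ▸ finite_suffixCosets L)

end WordSubgroup

/-! ### Nontriviality of the derived subgroups, and infinite bases. -/

section DerivedSeries

variable {α : Type*}

/-- A 5-cycle and an adjacent transposition generate `S_5`, so two letters suffice and all others
can be killed. -/
theorem exists_hom_perm_surjective {a b : α} (hab : a ≠ b) :
    ∃ f : FreeGroup α →* Equiv.Perm (Fin 5), Function.Surjective f ∧
      ∀ c, c ≠ a → c ≠ b → f (of c) = 1 := by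
  classical
  let t : α → Equiv.Perm (Fin 5) := fun c =>
    if c = a then finRotate 5 else if c = b then Equiv.swap 0 (finRotate 5 0) else 1
  refine ⟨lift t, ?_, fun c hca hcb => by simp [t, hca, hcb]⟩
  rw [← MonoidHom.range_eq_top, range_lift_eq_closure, eq_top_iff,
    ← Equiv.Perm.closure_cycle_adjacent_swap isCycle_finRotate support_finRotate 0]
  refine Subgroup.closure_mono ?_
  rintro σ (rfl | rfl)
  · exact ⟨a, by simp [t]⟩
  · exact ⟨b, by simp [t, hab.symm]⟩

theorem not_derivedSeries_le_ker {G : Type*} [Group G] {f : G →* Equiv.Perm (Fin 5)}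
    (hf : Function.Surjective f) (k : ℕ) : ¬ derivedSeries G k ≤ f.ker := by
  intro h
  refine Equiv.Perm.not_isSolvable_fin_5 ⟨k, ?_⟩
  rw [← map_derivedSeries_eq hf, Subgroup.map_eq_bot_iff]
  exact h

theorem derivedSeries_ne_bot [Nontrivial α] (k : ℕ) : derivedSeries (FreeGroup α) k ≠ ⊥ := by
  obtain ⟨a, b, hab⟩ := exists_pair_ne α
  obtain ⟨f, hf, -⟩ := exists_hom_perm_surjective hab
  exact fun h => not_derivedSeries_le_ker hf k (h ▸ bot_le)

/-- Send two letters absent from the generating words onto generators of `S_5` and the others to 1.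
This kills `K` but not the derived subgroup. -/
theorem not_fg_of_derivedSeries_le [Infinite α] {k : ℕ} {K : Subgroup (FreeGroup α)}
    (hK : derivedSeries (FreeGroup α) k ≤ K) : ¬ K.FG := by
  classical
  intro hfg
  obtain ⟨L, rfl⟩ := exists_wordSubgroup_eq hfg
  let S : Finset α := (L.flatten.map Prod.fst).toFinset
  obtain ⟨a, ha⟩ := Infinite.exists_notMem_finset S
  obtain ⟨b, hb⟩ := Infinite.exists_notMem_finset (insert a S)
  rw [Finset.mem_insert, not_or] at hb
  obtain ⟨f, hf, hf1⟩ := exists_hom_perm_surjective (Ne.symm hb.1)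
  refine not_derivedSeries_le_ker hf k (hK.trans ((Subgroup.closure_le _).2 ?_))
  rintro _ ⟨w, hw, rfl⟩
  have hlift : f = lift fun c => f (of c) := by ext1 c; simp
  rw [SetLike.mem_coe, MonoidHom.mem_ker, hlift, lift_mk]
  refine List.prod_eq_one fun σ hσ => ?_
  obtain ⟨x, hx, rfl⟩ := List.mem_map.1 hσ
  have hxS : x.1 ∈ S := by
    simp only [S, List.mem_toFinset, List.mem_map, List.mem_flatten]
    exact ⟨x, ⟨w, hw, hx⟩, rfl⟩
  have : f (of x.1) = 1 := hf1 _ (by rintro rfl; exact ha hxS) (by rintro rfl; exact hb.2 hxS)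
  cases x.2 <;> simp [this]

theorem commute_of_subsingleton [Subsingleton α] (x y : FreeGroup α) : x * y = y * x := by
  have h : ∀ x : FreeGroup α, ∀ a, x * of a = of a * x := fun x a => by
    induction x using FreeGroup.induction_on with
    | C1 => simp
    | of b => rw [Subsingleton.elim a b]
    | inv_of b _ => rw [Subsingleton.elim a b]; simp
    | mul x y hx hy => rw [mul_assoc, hy, ← mul_assoc, hx, mul_assoc]
  induction y using FreeGroup.induction_on with
  | C1 => simp
  | of a => exact h x a
  | inv_of a _ => exact (Commute.inv_right (h x a) : Commute x (of a)⁻¹)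
  | mul y z hy hz => exact (Commute.mul_right hy hz : Commute x (y * z))

theorem derivedSeries_eq_bot_of_subsingleton [Subsingleton α] {k : ℕ} (hk : 1 ≤ k) :
    derivedSeries (FreeGroup α) k = ⊥ := by
  refine le_bot_iff.1 ((derivedSeries_antitone _ hk).trans ?_)
  rw [derivedSeries_succ, Subgroup.commutator_le]
  intro x _ y _
  rw [Subgroup.mem_bot, commutatorElement_eq_one_iff_mul_comm]
  exact commute_of_subsingleton x y

end DerivedSeries

/-! ### Completing finite partial actions. -/

section Extension

variable {α X : Type*}

/-- Transported by `j`, the part of `e` that stays inside `s` is a partial injection of a finite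
set, and such a map extends to a permutation. -/
theorem exists_perm_extending {β : Type*} [Finite β] {s : Set X} {j : X → β}
    (hj : Set.InjOn j s) (e : Equiv.Perm X) :
    ∃ σ : Equiv.Perm β, ∀ x ∈ s, e x ∈ s → σ (j x) = j (e x) := by
  let T := {x : X // x ∈ s ∧ e x ∈ s}
  have hinj : Function.Injective fun x : T => j x :=
    fun x y h => Subtype.ext (hj x.2.1 y.2.1 h)
  have : Finite T := Finite.of_injective _ hinj
  obtain ⟨σ, hσ⟩ := Equiv.Perm.exists_extending_pair (fun x : T => j x) (fun x : T => j (e x)) hinj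
    fun x y h => Subtype.ext (e.injective (hj x.2.2 y.2.2 h))
  exact ⟨σ, fun x hx hex => hσ ⟨x, hx, hex⟩⟩

/-- A finite part of an action of a free group can be completed to a finite action. -/
theorem exists_perms_extending [MulAction (FreeGroup α) X] {β : Type*} [Finite β] {s : Set X}
    {j : X → β} (hj : Set.InjOn j s) : ∃ t : α → Equiv.Perm β, ∀ (w : List (α × Bool)) (x : X),
      (∀ u, u <:+ w → mk u • x ∈ s) → lift t (mk w) (j x) = j (mk w • x) := by
  choose t ht using fun a : α =>
    exists_perm_extending hj (MulAction.toPerm (α := FreeGroup α) (β := X) (of a))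
  refine ⟨t, fun w x hw => ?_⟩
  induction w with
  | nil => rw [← one_eq_mk, _root_.map_one, one_smul, Equiv.Perm.one_apply]
  | cons y w ih =>
    have hws := hw w (List.suffix_cons y w)
    have hys := hw _ List.suffix_rfl
    specialize ih fun u hu => hw u (hu.trans (List.suffix_cons y w))
    obtain ⟨a, b⟩ := y
    cases b
    · have hmk : mk ((a, false) :: w) = (of a)⁻¹ * mk w := rfl
      rw [hmk] at hys ⊢
      rw [_root_.map_mul, Equiv.Perm.mul_apply, ih, _root_.map_inv, lift_apply_of, Equiv.Perm.inv_eq_iff_eq]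
      have := ht a _ hys
      rw [MulAction.toPerm_apply, mul_smul, smul_inv_smul] at this
      rw [mul_smul]
      exact (this hws).symm
    · have hmk : mk ((a, true) :: w) = of a * mk w := rfl
      rw [hmk] at hys ⊢
      rw [_root_.map_mul, Equiv.Perm.mul_apply, ih, lift_apply_of, mul_smul]
      exact ht a _ hws (by rwa [mul_smul] at hys)

theorem exists_injOn_fin {s : Set X} (hs : s.Finite) {N : ℕ} (hN : s.ncard ≤ N + 1) (x : X) :
    ∃ j : X → Fin (N + 1), Set.InjOn j s ∧ j x = 0 := by
  obtain ⟨j, -, (hj : Set.InjOn j s)⟩ := hs.exists_injOn_of_encard_le (t := (Set.univ : Set (Fin (N + 1)))) (by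
    rw [← hs.cast_ncard_eq, Set.encard_univ, ENat.card_eq_coe_fintype_card, Fintype.card_fin]
    exact_mod_cast hN)
  exact ⟨Equiv.swap 0 (j x) ∘ j, (Equiv.injective _).comp_injOn hj, by simp⟩

end Extension

end FreeGroup

/-! ### Separation, closedness, and a finite test for containing the derived subgroup. -/

namespace FreeGroup

variable {α : Type*}

theorem lift_apply_eq_of_mem_wordSubgroup {β : Type*} {L : List (List (α × Bool))}
    {t : α → Equiv.Perm β} {x : β} (ht : ∀ w ∈ L, lift t (mk w) x = x) {h : FreeGroup α}
    (hh : h ∈ wordSubgroup L) : lift t h x = x := by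
  have hle : wordSubgroup L ≤ (MulAction.stabilizer (Equiv.Perm β) x).comap (lift t) := by
    refine (Subgroup.closure_le _).2 ?_
    rintro _ ⟨w, hw, rfl⟩
    exact ht w hw
  exact hle hh

theorem smul_coe_one {K : Subgroup (FreeGroup α)} (g : FreeGroup α) :
    g • ((1 : FreeGroup α) : FreeGroup α ⧸ K) = g := by
  rw [MulAction.Quotient.smul_coe, smul_eq_mul, mul_one]

theorem coe_eq_coe_one_iff {K : Subgroup (FreeGroup α)} {g : FreeGroup α} :
    (g : FreeGroup α ⧸ K) = (1 : FreeGroup α) ↔ g ∈ K := by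
  rw [eq_comm, QuotientGroup.eq, inv_one, one_mul]

/-- The action of the free group on finitely many cosets of a subgroup generated by words, among
them the cosets of the suffixes of these words, can be completed to a finite action. -/
theorem exists_perms_extending_cosets (L : List (List (α × Bool)))
    {s : Set (FreeGroup α ⧸ wordSubgroup L)} (hs : s.Finite) (hLs : suffixCosets L ⊆ s) {N : ℕ}
    (hN : s.ncard ≤ N + 1) :
    ∃ (j : FreeGroup α ⧸ wordSubgroup L → Fin (N + 1)) (t : α → Equiv.Perm (Fin (N + 1))),
      Set.InjOn j s ∧ j (1 : FreeGroup α) = 0 ∧ (∀ w ∈ L, lift t (mk w) 0 = 0) ∧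
      ∀ w, (∀ u, u <:+ w → (mk u : FreeGroup α ⧸ wordSubgroup L) ∈ s) →
        lift t (mk w) 0 = j (mk w) := by
  obtain ⟨j, hj, hj1⟩ := exists_injOn_fin hs hN ((1 : FreeGroup α) : FreeGroup α ⧸ wordSubgroup L)
  obtain ⟨t, ht⟩ := exists_perms_extending (α := α) hj
  have ht' : ∀ w, (∀ u, u <:+ w → (mk u : FreeGroup α ⧸ wordSubgroup L) ∈ s) →
      lift t (mk w) 0 = j (mk w) := fun w hw => by
    have := ht w ((1 : FreeGroup α) : FreeGroup α ⧸ wordSubgroup L) fun u hu => by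
      rw [smul_coe_one]
      exact hw u hu
    rwa [smul_coe_one, hj1] at this
  refine ⟨j, t, hj, hj1, fun w hw => ?_, ht'⟩
  rw [ht' w fun u hu => hLs (suffix_mem_suffixCosets hw hu),
    coe_eq_coe_one_iff.2 (mk_mem_wordSubgroup hw), hj1]

/-- **M. Hall's theorem**: a finitely generated subgroup of a free group is separated from every
element outside it by a finite permutation representation. -/
theorem exists_perms_fixing_of_notMem {L : List (List (α × Bool))} {g : FreeGroup α}
    (hg : g ∉ wordSubgroup L) : ∃ (N : ℕ) (t : α → Equiv.Perm (Fin (N + 1))),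
      (∀ w ∈ L, lift t (mk w) 0 = 0) ∧ lift t g 0 ≠ 0 := by
  classical
  -- Including the suffixes of `g` makes the completed action follow the whole path of `g`, whose
  -- endpoint differs from the base coset.
  let s : Set (FreeGroup α ⧸ wordSubgroup L) :=
    (fun u => (mk u : FreeGroup α ⧸ wordSubgroup L)) '' {u | u ∈ suffixes (g.toWord :: L)}
  have hs : s.Finite := (List.finite_toSet (suffixes (g.toWord :: L))).image _
  have hLs : suffixCosets L ⊆ s := Set.image_mono fun u hu => by
    have hu' : u ∈ suffixes L := hu
    refine mem_suffixes.2 ?_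
    rw [mem_suffixes] at hu'
    rw [List.exists_mem_cons_iff]
    tauto
  obtain ⟨j, t, hj, hj1, htL, ht⟩ :=
    exists_perms_extending_cosets L hs hLs (N := s.ncard) (Nat.le_succ _)
  have hgs : ∀ u, u <:+ g.toWord → (mk u : FreeGroup α ⧸ wordSubgroup L) ∈ s := fun u hu =>
    ⟨u, mem_suffixes.2 (.inr ⟨_, List.mem_cons_self, hu⟩), rfl⟩
  refine ⟨s.ncard, t, htL, fun h => hg ?_⟩
  have hgw := ht g.toWord hgs
  have hg1 := hgs _ List.suffix_rfl
  rw [mk_toWord] at hgw hg1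
  rw [h, ← hj1] at hgw
  exact coe_eq_coe_one_iff.1 (hj (hLs (one_mem_suffixCosets L)) hg1 hgw).symm

theorem isClosed_iff_derivedSeries_le {k : ℕ} (hk : 1 ≤ k) {H : Subgroup (FreeGroup α)}
    (hH : H.FG) : IsClosed[proTopology (FiniteKSolvable k) (FreeGroup α)]
      (H : Set (FreeGroup α)) ↔ derivedSeries (FreeGroup α) k ≤ H := by
  refine ⟨derivedSeries_le_of_isClosed, fun hle => ?_⟩
  rcases subsingleton_or_nontrivial α with hα | hα
  · obtain ⟨L, rfl⟩ := exists_wordSubgroup_eq hH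
    refine isClosed_of_forall_exists_hom fun g hg => ?_
    obtain ⟨N, t, htL, htg⟩ := exists_perms_fixing_of_notMem hg
    refine exists_hom_of_perm (lift t) ?_ (fun h => lift_apply_eq_of_mem_wordSubgroup htL) htg
    rw [derivedSeries_eq_bot_of_subsingleton hk]
    exact bot_le
  · have := derivedSeries_normal (FreeGroup α) k
    have := finite_quotient_of_normal_le hH (derivedSeries_ne_bot k) hle
    exact isClosed_of_derivedSeries_le hle

/-- The group is infinite cyclic: a nontrivial element of `K` is a nonzero power of the generator,
whose image in the quotient thus has finite order. -/
theorem finite_quotient_of_unique [Unique α] {K : Subgroup (FreeGroup α)} (hK : K ≠ ⊥) :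
    Finite (FreeGroup α ⧸ K) := by
  have hz : ∀ g : FreeGroup α, g ∈ Subgroup.zpowers (of (default : α)) := fun g => by
    rw [Subgroup.zpowers_eq_closure, ← Set.range_unique, closure_range_of]
    exact Subgroup.mem_top g
  obtain ⟨h, hh, h1⟩ := K.bot_or_exists_ne_one.resolve_left hK
  obtain ⟨m, rfl⟩ := hz h
  have hm : m ≠ 0 := by
    rintro rfl
    exact h1 (zpow_zero _)
  have : K.Normal := ⟨fun n hn g => by rwa [commute_of_subsingleton g n, mul_inv_cancel_right]⟩
  have hfin : IsOfFinOrder (of (default : α) : FreeGroup α ⧸ K) := by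
    refine isOfFinOrder_iff_zpow_eq_one.2 ⟨m, hm, ?_⟩
    rw [← QuotientGroup.mk_zpow]
    exact (QuotientGroup.eq_one_iff _).2 hh
  refine Set.finite_univ_iff.1 ((finite_zpowers.2 hfin).subset fun x _ => ?_)
  obtain ⟨g, rfl⟩ := QuotientGroup.mk_surjective x
  obtain ⟨i, rfl⟩ := hz g
  exact ⟨i, (QuotientGroup.mk_zpow _ _ _).symm⟩

theorem fg_iff_finiteIndex_of_derivedSeries_le [Finite α] {k : ℕ} {K : Subgroup (FreeGroup α)}
    (hle : derivedSeries (FreeGroup α) k ≤ K) (hK : Nat.card α = 1 → K ≠ ⊥) :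
    K.FG ↔ K.FiniteIndex := by
  refine ⟨fun hfg => ?_, fun _ => (Group.fg_iff_subgroup_fg K).1 K.fg_of_index_ne_zero⟩
  suffices Finite (FreeGroup α ⧸ K) from Subgroup.finiteIndex_of_finite_quotient
  rcases subsingleton_or_nontrivial α with hα | hα
  · rcases isEmpty_or_nonempty α with hα' | hα'
    · infer_instance
    · obtain ⟨a⟩ := hα'
      have := uniqueOfSubsingleton a
      exact finite_quotient_of_unique (hK Nat.card_unique)
  · have := derivedSeries_normal (FreeGroup α) k
    exact finite_quotient_of_normal_le hfg (derivedSeries_ne_bot k) hle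

/-- A subgroup generated by words contains the `k`-th derived subgroup if and only if this can be
seen in all the permutation representations of one degree, computed from the words. -/
theorem derivedSeries_le_wordSubgroup_iff [Nontrivial α] (k : ℕ) (L : List (List (α × Bool))) :
    derivedSeries (FreeGroup α) k ≤ wordSubgroup L ↔
      ∀ t : α → Equiv.Perm (Fin ((suffixes L).length + 1)), (∀ w ∈ L, lift t (mk w) 0 = 0) →
        (∀ p ∈ suffixes L, ∀ a, ∃ q ∈ suffixes L,
          lift t (mk ((a, true) :: p)) 0 = lift t (mk q) 0) ∧
        ∀ d ∈ derivedSeries (FreeGroup α) k, lift t d 0 = 0 := by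
  constructor
  · intro hle t ht
    -- When the words fix 0, so does the subgroup, hence the image of 0 under `g` depends only on
    -- the coset of `g`.
    refine ⟨fun p _ a => ?_, fun d hd => lift_apply_eq_of_mem_wordSubgroup ht (hle hd)⟩
    have := derivedSeries_normal (FreeGroup α) k
    obtain ⟨q, hq, hpq⟩ : (mk ((a, true) :: p) : FreeGroup α ⧸ wordSubgroup L) ∈ suffixCosets L :=
      suffixCosets_eq_univ (derivedSeries_ne_bot k) hle ▸ Set.mem_univ _
    refine ⟨q, hq, ?_⟩
    have h0 := lift_apply_eq_of_mem_wordSubgroup ht (QuotientGroup.eq.1 hpq)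
    rwa [_root_.map_mul, _root_.map_inv, Equiv.Perm.mul_apply, Equiv.Perm.inv_eq_iff_eq] at h0
  · intro h
    have hmul (a : α) (p : List (α × Bool)) : mk ((a, true) :: p) = of a * mk p := rfl
    have hclosed (a : α) : ∀ x ∈ suffixCosets L, of a • x ∈ suffixCosets L := by
      rintro _ ⟨p, hp, rfl⟩
      by_contra hna
      rw [MulAction.Quotient.smul_coe, smul_eq_mul, ← hmul] at hna
      -- An edge leaving the suffix cosets would add one new coset. The `+ 1` in the degree leaves
      -- room for it, and a completed action keeping it distinct violates the first condition.
      let s := insert (mk ((a, true) :: p) : FreeGroup α ⧸ wordSubgroup L) (suffixCosets L)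
      obtain ⟨j, t, hj, -, htL, ht⟩ := exists_perms_extending_cosets L (s := s)
        ((finite_suffixCosets L).insert _) (Set.subset_insert _ _) (N := (suffixes L).length)
        ((Set.ncard_insert_le _ _).trans (Nat.succ_le_succ (ncard_suffixCosets_le L)))
      have hsuf : ∀ q ∈ suffixes L, ∀ u, u <:+ q →
          (mk u : FreeGroup α ⧸ wordSubgroup L) ∈ s := fun q hq u hu =>
        .inr ⟨u, mem_suffixes_of_isSuffix hq hu, rfl⟩
      obtain ⟨q, hq, hpq⟩ := (h t htL).1 p hp a
      rw [ht q (hsuf q hq), ht ((a, true) :: p)] at hpq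
      · have := hj (.inl rfl) (hsuf q hq q List.suffix_rfl) hpq
        exact hna (this ▸ ⟨q, hq, rfl⟩)
      · intro u hu
        rcases List.suffix_cons_iff.1 hu with rfl | hu
        · exact .inl rfl
        · exact hsuf p hp u hu
    have hinv (a : α) : ∀ x ∈ suffixCosets L, (of a)⁻¹ • x ∈ suffixCosets L := by
      intro x hx
      -- An injective map of a finite set into itself is onto, so closure under letters gives
      -- closure under their inverses.
      have himage : (of a • ·) '' suffixCosets L = suffixCosets L :=
        Set.eq_of_subset_of_ncard_le (Set.image_subset_iff.2 (hclosed a))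
          (Set.ncard_image_of_injective _ (MulAction.injective (of a))).ge (finite_suffixCosets L)
      obtain ⟨y, hy, rfl⟩ := himage.superset hx
      simpa using hy
    have huniv : ∀ g : FreeGroup α, (g : FreeGroup α ⧸ wordSubgroup L) ∈ suffixCosets L := by
      have : ∀ g : FreeGroup α, ∀ x ∈ suffixCosets L, g • x ∈ suffixCosets L := fun g => by
        induction g using FreeGroup.induction_on with
        | C1 => simp
        | of a => exact hclosed a
        | inv_of a _ => exact hinv a
        | mul g g' hg hg' => exact fun x hx => by rw [mul_smul]; exact hg _ (hg' x hx)
      intro g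
      rw [← smul_coe_one g]
      exact this g _ (one_mem_suffixCosets L)
    intro d hd
    -- Every coset is now a suffix coset, so this completed action is the coset action itself, and
    -- fixing 0 means lying in the subgroup.
    obtain ⟨j, t, hj, hj1, htL, ht⟩ := exists_perms_extending_cosets L (finite_suffixCosets L)
      subset_rfl ((ncard_suffixCosets_le L).trans (Nat.le_succ _))
    have hd0 := (h t htL).2 d hd
    obtain ⟨w, rfl⟩ : ∃ w, mk w = d := Quot.exists_rep d
    rw [ht w fun u _ => huniv _, ← hj1] at hd0
    exact coe_eq_coe_one_iff.1 (hj (huniv _) (huniv _) hd0)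

end FreeGroup

/-! Permutations of `Fin N` coded by the lists of their values, and their computation. -/

namespace PermCode

/-- The list of values of a permutation of `Fin N`. -/
def code {N : ℕ} (σ : Equiv.Perm (Fin N)) : List ℕ :=
  List.ofFn fun i => (σ i : ℕ)

/-- Composition of coded permutations. -/
def comp (l l' : List ℕ) : List ℕ :=
  l'.map fun i => l.getD i 0

/-- Inversion of coded permutations. -/
def inv (l : List ℕ) : List ℕ :=
  (List.range l.length).map fun i => l.idxOf i

/-- Product of a list of coded permutations of degree `N`. -/
def prod (N : ℕ) (T : List (List ℕ)) : List ℕ :=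
  T.foldr comp (List.range N)

/-- Commutator of coded permutations. -/
def comm (l l' : List ℕ) : List ℕ :=
  comp (comp (comp l l') (inv l)) (inv l')

/-- All lists of length `m` with entries from a given list. -/
def tuples {β : Type*} (c : List β) (m : ℕ) : List (List β) :=
  m.rec [[]] fun _ r => c.flatMap fun x => r.map fun l => x :: l

/-- The codes of all permutations of `Fin N`. -/
def perms (N : ℕ) : List (List ℕ) :=
  (tuples (List.range N) N).filter fun l => ∀ i ∈ List.range N, i ∈ l

/-- The codes of the elements of the subgroup generated by a list of coded permutations. -/
def generated (N : ℕ) (T : List (List ℕ)) : List (List ℕ) :=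
  (tuples (List.range N :: T) (perms N).length).map (prod N)

/-- The codes of the elements of the `k`-th derived subgroup of the group generated by a list of
coded permutations. -/
def derived (N : ℕ) (T : List (List ℕ)) (k : ℕ) : List (List ℕ) :=
  k.rec (generated N T) fun _ D => generated N (D.flatMap fun l => D.map fun l' => comm l l')

/-- The value of a word when its letters are replaced by coded permutations. -/
def word {n : ℕ} (N : ℕ) (t : List (List ℕ)) (w : List (Fin n × Bool)) : List ℕ :=
  prod N (w.map fun x => bif x.2 then t.getD x.1 [] else inv (t.getD x.1 []))

variable {N : ℕ}

@[simp] theorem length_code (σ : Equiv.Perm (Fin N)) : (code σ).length = N := List.length_ofFn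

@[simp] theorem getElem_code (σ : Equiv.Perm (Fin N)) {i : ℕ} (hi : i < (code σ).length) :
    (code σ)[i] = σ ⟨i, by simpa using hi⟩ := by
  simp [code]

theorem getD_code (σ : Equiv.Perm (Fin N)) (i : Fin N) : (code σ).getD i 0 = σ i := by
  rw [List.getD_eq_getElem _ _ (by simp)]
  simp

theorem code_injective : Function.Injective (code : Equiv.Perm (Fin N) → List ℕ) := by
  intro σ τ h
  ext i
  rw [← getD_code, h, getD_code]

theorem code_one : code (1 : Equiv.Perm (Fin N)) = List.range N := by
  refine List.ext_getElem (by simp) fun i _ _ => by simp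

theorem comp_code (σ τ : Equiv.Perm (Fin N)) : comp (code σ) (code τ) = code (σ * τ) := by
  refine List.ext_getElem (by simp [comp]) fun i h _ => ?_
  simp only [comp, List.getElem_map, getElem_code, getD_code, Equiv.Perm.mul_apply]

theorem nodup_code (σ : Equiv.Perm (Fin N)) : (code σ).Nodup :=
  List.nodup_ofFn.2 (Fin.val_injective.comp σ.injective)

/-- Codes have no repeated entries, so the index of a value is its preimage. -/
theorem inv_code (σ : Equiv.Perm (Fin N)) : inv (code σ) = code σ⁻¹ := by
  refine List.ext_getElem (by simp [inv]) fun i h _ => ?_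
  have hi : i < N := by simpa [inv] using h
  simp only [inv, List.getElem_map, List.getElem_range, getElem_code]
  have := (nodup_code σ).idxOf_getElem (σ⁻¹ ⟨i, hi⟩) (by simp)
  simpa using this

open scoped commutatorElement in
theorem comm_code (σ τ : Equiv.Perm (Fin N)) : comm (code σ) (code τ) = code ⁅σ, τ⁆ := by
  simp only [comm, comp_code, inv_code, commutatorElement_def]

theorem prod_map_code (T : List (Equiv.Perm (Fin N))) : prod N (T.map code) = code T.prod := by
  induction T with
  | nil => exact code_one.symm
  | cons σ T ih =>
    change comp (code σ) (prod N (T.map code)) = _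
    rw [ih, comp_code, List.prod_cons]

theorem mem_tuples {β : Type*} {c : List β} {m : ℕ} {l : List β} :
    l ∈ tuples c m ↔ l.length = m ∧ ∀ x ∈ l, x ∈ c := by
  induction m generalizing l with
  | zero =>
    change l ∈ [[]] ↔ _
    rw [List.mem_singleton, List.length_eq_zero_iff]
    exact ⟨by rintro rfl; simp, And.left⟩
  | succ m ih =>
    change l ∈ c.flatMap (fun x => (tuples c m).map fun l => x :: l) ↔ _
    simp only [List.mem_flatMap, List.mem_map, ih]
    constructor
    · rintro ⟨x, hx, l, ⟨rfl, hl⟩, rfl⟩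
      simpa [hx] using hl
    · rintro ⟨hl, h⟩
      rcases l with _ | ⟨x, l⟩
      · simp at hl
      · exact ⟨x, h x (by simp), l, ⟨by simpa using hl, fun y hy => h y (by simp [hy])⟩, rfl⟩

theorem mem_perms {l : List ℕ} : l ∈ perms N ↔ ∃ σ : Equiv.Perm (Fin N), code σ = l := by
  simp only [perms, List.mem_filter, mem_tuples, List.mem_range, decide_eq_true_eq]
  constructor
  · rintro ⟨⟨rfl, hl⟩, hsurj⟩
    let f : Fin l.length → Fin l.length := fun i => ⟨l[i], hl _ (List.getElem_mem _)⟩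
    have hf : Function.Surjective f := fun i => by
      obtain ⟨j, hj, hji⟩ := List.mem_iff_getElem.1 (hsurj i i.2)
      exact ⟨⟨j, hj⟩, Fin.ext hji⟩
    exact ⟨Equiv.ofBijective f hf.bijective_of_finite, List.ext_getElem (by simp) (by simp [f])⟩
  · rintro ⟨σ, rfl⟩
    refine ⟨⟨length_code σ, fun x hx => ?_⟩, fun i hi => ?_⟩
    · obtain ⟨j, rfl⟩ := List.mem_ofFn.1 hx
      exact (σ j).2
    · exact List.mem_ofFn.2 ⟨σ⁻¹ ⟨i, hi⟩, by simp⟩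

theorem card_perm_le_length_perms : Fintype.card (Equiv.Perm (Fin N)) ≤ (perms N).length := by
  classical
  rw [← Finset.card_univ, ← Finset.card_image_of_injective _ code_injective]
  refine (Finset.card_le_card fun l hl => ?_).trans (List.toFinset_card_le (perms N))
  obtain ⟨σ, -, rfl⟩ := Finset.mem_image.1 hl
  exact List.mem_toFinset.2 (mem_perms.2 ⟨σ, rfl⟩)

theorem _root_.Set.mem_pow_iff_exists_list {M : Type*} [Monoid M] {S : Set M} {m : ℕ} {a : M} :
    a ∈ S ^ m ↔ ∃ l : List M, l.length = m ∧ (∀ x ∈ l, x ∈ S) ∧ l.prod = a := by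
  induction m generalizing a with
  | zero =>
    rw [pow_zero, Set.mem_one]
    constructor
    · rintro rfl
      exact ⟨[], by simp⟩
    · rintro ⟨l, hl, -, rfl⟩
      rw [List.length_eq_zero_iff.1 hl, List.prod_nil]
  | succ m ih =>
    rw [pow_succ', Set.mem_mul]
    constructor
    · rintro ⟨x, hx, b, hb, rfl⟩
      obtain ⟨l, rfl, hl, rfl⟩ := ih.1 hb
      exact ⟨x :: l, rfl, List.forall_mem_cons.2 ⟨hx, hl⟩, List.prod_cons⟩
    · rintro ⟨_ | ⟨x, l⟩, hlen, hl, rfl⟩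
      · simp at hlen
      · rw [List.forall_mem_cons] at hl
        exact ⟨x, hl.1, l.prod, ih.2 ⟨l, by simpa using hlen, hl.2, rfl⟩, List.prod_cons.symm⟩

/-- The powers of `S` increase because `1 ∈ S`, and their sizes are constant from exponent `|G|` on.
So `S ^ m` is closed under products, and in a finite group a submonoid closure is a subgroup
closure. -/
theorem _root_.Group.coe_closure_eq_pow {G : Type*} [Group G] [Fintype G] {S : Set G} (h1 : 1 ∈ S)
    {m : ℕ} (hm : Fintype.card G ≤ m) : (Subgroup.closure S : Set G) = S ^ m := by
  classical
  have hmono {i j : ℕ} (hij : i ≤ j) : S ^ i ⊆ S ^ j := Set.pow_subset_pow_right h1 hij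
  have heq {i : ℕ} (hi : m ≤ i) : S ^ m = S ^ i := by
    refine Set.eq_of_subset_of_card_le (hmono hi) (le_of_eq ?_)
    rw [Group.card_pow_eq_card_pow_card_univ S m hm,
      Group.card_pow_eq_card_pow_card_univ S i (hm.trans hi)]
  let M : Submonoid G :=
    { carrier := S ^ m
      one_mem' := hmono (Nat.zero_le m) (by simp)
      mul_mem' := fun {a b} ha hb => by
        rw [heq (Nat.le_add_right m m), pow_add]
        exact Set.mul_mem_mul ha hb }
  refine subset_antisymm ?_ ?_
  · have hm0 : 1 ≤ m := Fintype.card_pos.trans_le hm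
    have : Submonoid.closure S ≤ M := Submonoid.closure_le.2 (by
      have h := hmono hm0
      rwa [pow_one] at h)
    intro g hg
    refine this ?_
    rw [← Subgroup.closure_toSubmonoid_of_finite]
    exact hg
  · intro g hg
    obtain ⟨l, -, hl, rfl⟩ := Set.mem_pow_iff_exists_list.1 hg
    exact list_prod_mem fun x hx => Subgroup.subset_closure (hl x hx)

/-- The list `T` consists of the codes of the elements of `U`. -/
def Represents (T : List (List ℕ)) (U : Set (Equiv.Perm (Fin N))) : Prop :=
  ∀ l, l ∈ T ↔ ∃ σ ∈ U, code σ = l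

theorem Represents.exists_map {T : List (List ℕ)} {U : Set (Equiv.Perm (Fin N))}
    (h : Represents T U) {m : List (List ℕ)} (hm : ∀ l ∈ m, l ∈ T) :
    ∃ u : List (Equiv.Perm (Fin N)), (∀ σ ∈ u, σ ∈ U) ∧ u.map code = m := by
  induction m with
  | nil => exact ⟨[], by simp, rfl⟩
  | cons l m ih =>
    obtain ⟨σ, hσ, rfl⟩ := (h l).1 (hm l (by simp))
    obtain ⟨u, hu, rfl⟩ := ih fun l hl => hm l (by simp [hl])
    exact ⟨σ :: u, by simpa [hσ] using hu, rfl⟩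

theorem Represents.generated {T : List (List ℕ)} {U : Set (Equiv.Perm (Fin N))}
    (h : Represents T U) :
    Represents (generated N T) (Subgroup.closure U : Set (Equiv.Perm (Fin N))) := by
  -- The identity pads shorter products, so products of one fixed length exhaust the generated
  -- subgroup.
  have h1 : Represents (List.range N :: T) (insert 1 U) := fun l => by
    rw [List.mem_cons, h l, ← code_one, Set.exists_mem_insert, eq_comm]
  have hcl : (Subgroup.closure U : Set (Equiv.Perm (Fin N))) = insert 1 U ^ (perms N).length := by
    rw [← Subgroup.closure_insert_one,
      Group.coe_closure_eq_pow (Set.mem_insert _ _) card_perm_le_length_perms]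
  intro l
  simp only [PermCode.generated, List.mem_map, mem_tuples]
  rw [hcl]
  constructor
  · rintro ⟨m, ⟨hm, hmT⟩, rfl⟩
    obtain ⟨u, hu, rfl⟩ := h1.exists_map hmT
    exact ⟨u.prod, Set.mem_pow_iff_exists_list.2 ⟨u, by simpa using hm, hu, rfl⟩,
      (prod_map_code u).symm⟩
  · rintro ⟨σ, hσ, rfl⟩
    obtain ⟨u, hu, huU, rfl⟩ := Set.mem_pow_iff_exists_list.1 hσ
    refine ⟨u.map code, ⟨by simpa using hu, fun l hl => ?_⟩, prod_map_code u⟩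
    obtain ⟨σ, hσ, rfl⟩ := List.mem_map.1 hl
    exact (h1 _).2 ⟨σ, huU σ hσ, rfl⟩

/-- Homomorphic images commute with commutator subgroups, so each term is generated by the
commutators of the elements listed for the previous one. -/
theorem Represents.derived {T : List (List ℕ)} {G : Type*} [Group G]
    {f : G →* Equiv.Perm (Fin N)} {U : Set (Equiv.Perm (Fin N))} (h : Represents T U)
    (hf : f.range = Subgroup.closure U) (k : ℕ) :
    Represents (derived N T k) ((derivedSeries G k).map f : Set (Equiv.Perm (Fin N))) := by
  induction k with
  | zero =>
    rw [derivedSeries_zero, ← MonoidHom.range_eq_map, hf]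
    exact h.generated
  | succ k ih =>
    rw [derivedSeries_succ, Subgroup.map_commutator, Subgroup.commutator_def]
    refine Represents.generated fun l => ?_
    simp only [List.mem_flatMap, List.mem_map]
    constructor
    · rintro ⟨_, ha, _, hb, rfl⟩
      obtain ⟨σ, hσ, rfl⟩ := (ih _).1 ha
      obtain ⟨τ, hτ, rfl⟩ := (ih _).1 hb
      exact ⟨_, ⟨σ, hσ, τ, hτ, rfl⟩, (comm_code σ τ).symm⟩
    · rintro ⟨_, ⟨σ, hσ, τ, hτ, rfl⟩, rfl⟩
      exact ⟨_, (ih _).2 ⟨σ, hσ, rfl⟩, _, (ih _).2 ⟨τ, hτ, rfl⟩, comm_code σ τ⟩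

/-- The table of codes of a family of permutations. -/
def table {n : ℕ} (τ : Fin n → Equiv.Perm (Fin N)) : List (List ℕ) :=
  List.ofFn fun i => code (τ i)

theorem represents_table {n : ℕ} (τ : Fin n → Equiv.Perm (Fin N)) :
    Represents (table τ) (Set.range τ) := fun l => by
  simp [table, List.mem_ofFn]

theorem mem_tuples_perms {n : ℕ} {t : List (List ℕ)} :
    t ∈ tuples (perms N) n ↔ ∃ τ : Fin n → Equiv.Perm (Fin N), table τ = t := by
  rw [mem_tuples]
  constructor
  · rintro ⟨rfl, ht⟩
    choose τ hτ using fun i : Fin t.length => mem_perms.1 (ht _ (List.getElem_mem i.2))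
    exact ⟨τ, List.ext_getElem (by simp [table]) fun i _ hi => by simp [table, hτ]⟩
  · rintro ⟨τ, rfl⟩
    refine ⟨by simp [table], fun l hl => ?_⟩
    obtain ⟨σ, -, hσ⟩ := (represents_table τ l).1 hl
    exact mem_perms.2 ⟨σ, hσ⟩

theorem word_table {n : ℕ} (τ : Fin n → Equiv.Perm (Fin N)) (w : List (Fin n × Bool)) :
    word N (table τ) w = code (FreeGroup.lift τ (FreeGroup.mk w)) := by
  rw [FreeGroup.lift_mk, ← prod_map_code, List.map_map, word]
  congr 2
  funext x
  have : (table τ).getD x.1 [] = code (τ x.1) := by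
    rw [List.getD_eq_getElem _ _ (by simp [table])]
    simp [table]
  rw [this]
  cases h : x.2 <;> simp [h, inv_code]

/-- The computable form of the condition that the subgroup generated by the words in `L` contains
the `k`-th derived subgroup. -/
def Criterion (n k : ℕ) (L : List (List (Fin n × Bool))) : Prop :=
  ∀ t ∈ tuples (perms ((FreeGroup.suffixes L).length + 1)) n,
    (∀ w ∈ L, (word ((FreeGroup.suffixes L).length + 1) t w).getD 0 0 = 0) →
      (∀ p ∈ FreeGroup.suffixes L, ∀ a ∈ List.finRange n, ∃ q ∈ FreeGroup.suffixes L,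
        (word ((FreeGroup.suffixes L).length + 1) t ((a, true) :: p)).getD 0 0 =
          (word ((FreeGroup.suffixes L).length + 1) t q).getD 0 0) ∧
      ∀ l ∈ derived ((FreeGroup.suffixes L).length + 1) t k, l.getD 0 0 = 0

theorem criterion_iff {n : ℕ} [Nontrivial (Fin n)] (k : ℕ) (L : List (List (Fin n × Bool))) :
    Criterion n k L ↔ derivedSeries (FreeGroup (Fin n)) k ≤ FreeGroup.wordSubgroup L := by
  rw [FreeGroup.derivedSeries_le_wordSubgroup_iff, Criterion]
  have h0 {N : ℕ} (σ : Equiv.Perm (Fin (N + 1))) : (code σ).getD 0 0 = σ 0 := getD_code σ 0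
  have hz {N : ℕ} (x : Fin (N + 1)) : (x : ℕ) = 0 ↔ x = 0 := Fin.val_eq_zero_iff
  simp only [mem_tuples_perms, forall_exists_index, forall_apply_eq_imp_iff, word_table, h0, hz,
    Fin.val_inj, List.mem_finRange, forall_true_left]
  refine forall_congr' fun τ => imp_congr_right fun _ => and_congr_right fun _ => ?_
  have hd := (represents_table τ).derived (f := FreeGroup.lift τ) FreeGroup.range_lift_eq_closure k
  constructor
  · intro h d hd'
    have := h _ ((hd _).2 ⟨_, ⟨d, hd', rfl⟩, rfl⟩)
    rwa [h0, hz] at this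
  · intro h l hl
    obtain ⟨_, ⟨d, hd', rfl⟩, rfl⟩ := (hd l).1 hl
    rw [h0, hz]
    exact h d hd'

end PermCode

/-! ### Primitive recursiveness of the criterion. -/

theorem PrimrecPred.forall_mem {α β : Type*} [Primcodable α] [Primcodable β] {f : α → List β}
    {R : α → β → Prop} (hf : Primrec f) (hR : PrimrecRel R) :
    PrimrecPred fun a => ∀ b ∈ f a, R a b :=
  PrimrecRel.comp (PrimrecRel.forall_mem_list (PrimrecRel.swap hR)) hf .id

theorem PrimrecPred.exists_mem {α β : Type*} [Primcodable α] [Primcodable β] {f : α → List β}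
    {R : α → β → Prop} (hf : Primrec f) (hR : PrimrecRel R) :
    PrimrecPred fun a => ∃ b ∈ f a, R a b :=
  PrimrecRel.comp (PrimrecRel.exists_mem_list (PrimrecRel.swap hR)) hf .id

theorem PrimrecPred.imp {α : Type*} [Primcodable α] {p q : α → Prop} (hp : PrimrecPred p)
    (hq : PrimrecPred q) : PrimrecPred fun a => p a → q a :=
  (hp.not.or hq).of_eq fun _ => imp_iff_not_or.symm

theorem Primrec.list_tails {α : Type*} [Primcodable α] : Primrec (@List.tails α) :=
  (Primrec.list_rec (f := id) (g := fun _ => [[]])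
    (h := fun _ (p : α × List α × List (List α)) => (p.1 :: p.2.1) :: p.2.2) .id (.const _)
    (Primrec.list_cons.comp (Primrec.list_cons.comp (Primrec.fst.comp .snd)
      (Primrec.fst.comp (Primrec.snd.comp .snd))) (Primrec.snd.comp (Primrec.snd.comp .snd)))).of_eq
    fun l => by
      induction l with
      | nil => rfl
      | cons x l ih =>
        rw [List.tails_cons, ← ih]
        rfl

theorem Primrec.suffixes {α : Type*} [Primcodable α] : Primrec (@FreeGroup.suffixes α) :=
  Primrec.list_cons.comp (.const []) (Primrec.list_flatMap .id (Primrec.list_tails.comp .snd))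

namespace PermCode

open Primrec

theorem primrec_comp : Primrec₂ comp :=
  list_map snd ((list_getD 0).comp (fst.comp fst) snd)

theorem primrec_inv : Primrec inv :=
  list_map (list_range.comp list_length) (list_idxOf.comp snd fst)

theorem primrec_prod : Primrec₂ prod :=
  list_foldr (h := fun _ (p : List ℕ × List ℕ) => comp p.1 p.2) snd (list_range.comp fst)
    (primrec_comp.comp (fst.comp snd) (snd.comp snd))

theorem primrec_comm : Primrec₂ comm :=
  primrec_comp.comp (primrec_comp.comp (primrec_comp.comp fst snd) (primrec_inv.comp fst))
    (primrec_inv.comp snd)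

theorem primrec_tuples {β : Type*} [Primcodable β] : Primrec₂ (@tuples β) :=
  nat_rec (f := fun _ : List β => [[]])
    (g := fun c (p : ℕ × List (List β)) => c.flatMap fun x => p.2.map fun l => x :: l) (.const _)
    (list_flatMap fst
      (list_map (snd.comp (snd.comp fst)) (list_cons.comp (snd.comp fst) snd)))

theorem primrec_perms : Primrec perms := by
  have h : PrimrecRel fun (l : List ℕ) (N : ℕ) => ∀ i ∈ List.range N, i ∈ l :=
    -- List membership is expressed as a bounded existential over equality.
    (PrimrecPred.forall_mem (R := fun (p : List ℕ × ℕ) (i : ℕ) => ∃ j ∈ p.1, i = j) (list_range.comp snd)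
      (PrimrecPred.exists_mem (R := fun (p : (List ℕ × ℕ) × ℕ) j => p.2 = j) (fst.comp fst)
        (Primrec.eq.comp (snd.comp fst) snd))).of_eq fun p => by simp
  exact (PrimrecRel.listFilter h).comp (primrec_tuples.comp list_range .id) .id

theorem primrec_generated : Primrec₂ generated :=
  list_map (primrec_tuples.comp (list_cons.comp (list_range.comp fst) snd)
    (list_length.comp (primrec_perms.comp fst))) (primrec_prod.comp (fst.comp fst) snd)

theorem primrec_derived :
    Primrec fun p : (ℕ × List (List ℕ)) × ℕ => derived p.1.1 p.1.2 p.2 :=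
  nat_rec (f := fun p : ℕ × List (List ℕ) => generated p.1 p.2)
    (g := fun p (q : ℕ × List (List ℕ)) =>
      generated p.1 (q.2.flatMap fun l => q.2.map fun l' => comm l l')) primrec_generated
    (primrec_generated.comp (fst.comp fst) (list_flatMap (snd.comp snd)
      (list_map (snd.comp (snd.comp fst)) (primrec_comm.comp (snd.comp fst) snd))))

theorem primrec_word {n : ℕ} :
    Primrec fun p : (ℕ × List (List ℕ)) × List (Fin n × Bool) => word p.1.1 p.1.2 p.2 := by
  have h : Primrec₂ fun (p : (ℕ × List (List ℕ)) × List (Fin n × Bool)) (x : Fin n × Bool) =>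
      p.1.2.getD x.1 [] :=
    (list_getD []).comp (snd.comp (fst.comp fst)) (fin_val.comp (fst.comp snd))
  exact primrec_prod.comp (fst.comp fst)
    (list_map snd (.cond (snd.comp snd) h (primrec_inv.comp h)))

/-- All quantifiers range over lists computed from the input; the rank `n` is a fixed parameter. -/
theorem primrecPred_criterion (n : ℕ) :
    PrimrecPred fun p : ℕ × List (List (Fin n × Bool)) => Criterion n p.1 p.2 := by
  have hP : Primrec fun p : ℕ × List (List (Fin n × Bool)) => FreeGroup.suffixes p.2 :=
    Primrec.suffixes.comp snd
  have hN : Primrec fun p : ℕ × List (List (Fin n × Bool)) =>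
      (FreeGroup.suffixes p.2).length + 1 := succ.comp (list_length.comp hP)
  have hd : Primrec fun l : List ℕ => l.getD 0 0 := (list_getD 0).comp .id (.const 0)
  have hw {γ : Type} [Primcodable γ] {x : γ → ℕ × List (List (Fin n × Bool))}
      {t : γ → List (List ℕ)} {w : γ → List (Fin n × Bool)} (hx : Primrec x) (ht : Primrec t)
      (hw : Primrec w) : Primrec fun c =>
        (word ((FreeGroup.suffixes (x c).2).length + 1) (t c) (w c)).getD 0 0 :=
    hd.comp (primrec_word.comp (((hN.comp hx).pair ht).pair hw))
  refine .forall_mem (primrec_tuples.comp (primrec_perms.comp hN) (.const n)) ?_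
  refine .imp (.forall_mem (snd.comp fst) ?_) (.and ?_ ?_)
  · exact Primrec.eq.comp (hw (fst.comp fst) (snd.comp fst) snd) (.const 0)
  · refine .forall_mem (hP.comp fst) (.forall_mem (.const _) (.exists_mem (hP.comp ?_) ?_))
    · exact fst.comp (fst.comp fst)
    · refine Primrec.eq.comp (hw ?_ ?_ ?_) (hw ?_ ?_ snd)
      · exact fst.comp (fst.comp (fst.comp fst))
      · exact snd.comp (fst.comp (fst.comp fst))
      · exact list_cons.comp ((snd.comp fst).pair (.const true)) (snd.comp (fst.comp fst))
      · exact fst.comp (fst.comp (fst.comp fst))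
      · exact snd.comp (fst.comp (fst.comp fst))
  · refine .forall_mem ?_ (Primrec.eq.comp (hd.comp snd) (.const 0))
    exact primrec_derived.comp (((hN.comp fst).pair snd).pair (fst.comp fst))

end PermCode

/-! ### Decidability of closedness. -/

namespace FreeGroup

theorem subgroupOfWords_eq_wordSubgroup {A B : Type*} (ν : B → A) (L : List (List (B × Bool))) :
    subgroupOfWords ν L = wordSubgroup (L.map fun w => w.map fun x => (ν x.1, x.2)) := by
  simp only [subgroupOfWords, wordSubgroup, List.mem_map, exists_exists_and_eq_and]

theorem wordSubgroup_fg {α : Type*} (L : List (List (α × Bool))) : (wordSubgroup L).FG :=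
  (Subgroup.fg_iff _).2 ⟨_, rfl, ((List.finite_toSet L).image mk).subset
    fun _ ⟨w, hw, h⟩ => ⟨w, hw, h.symm⟩⟩

theorem map_wordSubgroup {α β : Type*} (f : α → β) (L : List (List (α × Bool))) :
    (wordSubgroup L).map (map f) =
      wordSubgroup (L.map fun w => w.map fun x => (f x.1, x.2)) := by
  rw [wordSubgroup, MonoidHom.map_closure, wordSubgroup]
  congr 1
  ext g
  constructor
  · rintro ⟨_, ⟨w, hw, rfl⟩, rfl⟩
    exact ⟨_, List.mem_map_of_mem hw, map.mk⟩
  · rintro ⟨_, hv, rfl⟩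
    obtain ⟨w, hw, rfl⟩ := List.mem_map.1 hv
    exact ⟨mk w, ⟨w, hw, rfl⟩, map.mk⟩

theorem derivedSeries_le_wordSubgroup_map_iff {α β : Type*} (e : α ≃ β) (k : ℕ)
    (L : List (List (α × Bool))) :
    derivedSeries (FreeGroup β) k ≤ wordSubgroup (L.map fun w => w.map fun x => (e x.1, x.2)) ↔
      derivedSeries (FreeGroup α) k ≤ wordSubgroup L := by
  rw [← map_wordSubgroup, ← map_derivedSeries_eq (f := map e) (map_surjective e.surjective),
    Subgroup.map_le_map_iff_of_injective (map_injective e.injective)]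

/-- For `k ≥ 1` the answer is always yes in rank at most one and always no for infinite `A`. In the
remaining case `B` is finite, so renaming letters through `ν` into `Fin n` is a finite table, and
the criterion applies. -/
theorem computablePred_isClosed {A B : Type*} [Primcodable B] (ν : B ↪ A) :
    ComputablePred fun p : ℕ × List (List (B × Bool)) =>
      1 ≤ p.1 ∧ IsClosed[proTopology (FiniteKSolvable p.1) (FreeGroup A)]
        (subgroupOfWords ν p.2 : Set (FreeGroup A)) := by
  have hclosed (p : ℕ × List (List (B × Bool))) :
      (1 ≤ p.1 ∧ derivedSeries (FreeGroup A) p.1 ≤ subgroupOfWords ν p.2) ↔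
        1 ≤ p.1 ∧ IsClosed[proTopology (FiniteKSolvable p.1) (FreeGroup A)]
          (subgroupOfWords ν p.2 : Set (FreeGroup A)) :=
    and_congr_right fun hk => (isClosed_iff_derivedSeries_le hk
      (subgroupOfWords_eq_wordSubgroup ν p.2 ▸ wordSubgroup_fg _)).symm
  refine ComputablePred.of_eq ?_ hclosed
  refine PrimrecPred.computablePred ?_
  have hk : PrimrecPred fun p : ℕ × List (List (B × Bool)) => 1 ≤ p.1 :=
    Primrec.nat_le.comp (.const 1) .fst
  rcases finite_or_infinite A with hA | hA
  · rcases subsingleton_or_nontrivial A with hA1 | hA1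
    · refine hk.of_eq fun p => (and_iff_left_of_imp fun hp => ?_).symm
      rw [derivedSeries_eq_bot_of_subsingleton hp]
      exact bot_le
    · obtain ⟨n, ⟨e⟩⟩ := Finite.exists_equiv_fin A
      have : Nontrivial (Fin n) := e.symm.nontrivial
      have : Finite B := Finite.of_injective ν ν.injective
      have hf : Primrec fun p : ℕ × List (List (B × Bool)) =>
          (p.1, p.2.map fun w => w.map fun x => (e (ν x.1), x.2)) :=
        Primrec.fst.pair (Primrec.list_map .snd (Primrec.list_map .snd
          (((Primrec.dom_finite fun b => e (ν b)).comp (Primrec.fst.comp .snd)).pair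
            (Primrec.snd.comp .snd))))
      refine hk.and (((PermCode.primrecPred_criterion n).comp hf).of_eq fun p => ?_)
      rw [PermCode.criterion_iff, subgroupOfWords_eq_wordSubgroup,
        ← derivedSeries_le_wordSubgroup_map_iff e]
      simp only [List.map_map, Function.comp_def]
  · refine PrimrecPred.of_eq (p := fun _ => False) ⟨inferInstance, .const _⟩ fun p => ?_
    refine iff_of_false id fun h => ?_
    exact not_fg_of_derivedSeries_le h.2
      (subgroupOfWords_eq_wordSubgroup ν p.2 ▸ wordSubgroup_fg _)

end FreeGroup

theorem theorem4p2 {A : Type*} :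
    (∀ (k : ℕ), 1 ≤ k → ∀ (H : Subgroup (FreeGroup A)), H.FG →
      ((H : Set (FreeGroup A)) * (derivedSeries (FreeGroup A) k : Set (FreeGroup A)) ⊆
        (proClosure (FiniteKSolvable k) H : Set (FreeGroup A))) ∧
      (Infinite A → ¬ (proClosure (FiniteKSolvable k) H).FG) ∧
      (Finite A → ¬ (Nat.card A = 1 ∧ H = ⊥) →
        ((proClosure (FiniteKSolvable k) H).FG ↔
          (proClosure (FiniteKSolvable k) H).FiniteIndex))) ∧
    (∀ {B : Type*} [Primcodable B] (ν : B ↪ A),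
      ComputablePred fun p : ℕ × List (List (B × Bool)) =>
        1 ≤ p.1 ∧
          IsClosed[proTopology (FiniteKSolvable p.1) (FreeGroup A)]
            (subgroupOfWords ν p.2 : Set (FreeGroup A))) := by
  refine ⟨fun k _ H _ => ⟨mul_derivedSeries_subset_proClosure k H, fun _ =>
    FreeGroup.not_fg_of_derivedSeries_le (derivedSeries_le_proClosure k H), fun _ hAH =>
    FreeGroup.fg_iff_finiteIndex_of_derivedSeries_le (derivedSeries_le_proClosure k H)
      fun hA hbot => hAH ⟨hA, ?_⟩⟩, fun ν => FreeGroup.computablePred_isClosed ν⟩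
  -- A trivial closure forces `H` to be trivial, so the excluded case may be stated for `H`.
  exact le_bot_iff.1 (hbot ▸ le_proClosure k H)
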